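/- Let $L,U,\beta$ be real numbers with $L>0$, $0<\beta<L/2$ and $2\beta\le U-L$. An input $I$ of the problem OCS-max (online conversion with switching costs, maximization) consists of a deadline $T$, rate constraints $d_1,\dots,d_T\in[0,1]$ with $\sum_t d_t\ge 1$, and price functions $g_1,\dots,g_T$, each with $g_t(0)=0$, concave and differentiable on $[0,1]$ with $L\le g_t'\le U$. A feasible solution is $x=(x_1,\dots,x_T)$ with $x_t\in[0,d_t]$ and $\sum_{t=1}^T x_t=1$; its profit is $$\sum_{t=1}^T g_t(x_t)-\sum_{t=1}^{T+1}\beta\,|x_t-x_{t-1}|,\qquad x_0=x_{T+1}=0.$$ $\mathrm{OPT}(I)$ is the supremum of the profit over feasible solutions. A deterministic online algorithm chooses $x_t$ as a function of $T$, $d_1,\dots,d_T$ (known in advance, as are $L,U,\beta$) and $g_1,\dots,g_t$ only, and its decisions are feasible on every input; $\mathrm{ALG}(I)$ is its profit on $I$. For $N\in\mathbb N$ let $\Omega_N$ be the set of inputs in which the compulsory trade cannot start before step $N$, i.e. $\sum_{\tau=k+1}^{T}d_\tau\ge 1$ for all $0\le k<N$ (so $\Omega_0$ is the set of all inputs). Then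 for every $N$ and every deterministic online algorithm, $$\sup_{I\in\Omega_N}\frac{\mathrm{OPT}(I)}{\mathrm{ALG}(I)}\;\ge\;\omega:=W\!\left(\frac{U/L-1-2\beta/L}{e^{1+2\beta/L}}\right)+1+\frac{2\beta}{L},$$ where $W$ is the (principal branch of the) Lambert $W$ function, the inverse of $w\mapsto we^w$. That is, no deterministic online algorithm for OCS-max has a competitive ratio better than $\omega$. -/

import Mathlib

noncomputable section

namespace OCSMax

/-- An input of the problem: a deadline `T`, the price functions and the rate constraints of the
`T` time steps. Time step `t ∈ {1, …, T}` is the index `t - 1 : Fin T`. -/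
structure Input where
  T : ℕ
  price : Fin T → ℝ → ℝ
  rate : Fin T → ℝ

/-- Admissible price functions: zero at zero, concave on the unit interval and differentiable
there with derivative in `[L, U]` (one-sided derivatives at the end points). -/
def IsPriceFunction (L U : ℝ) (g : ℝ → ℝ) : Prop :=
  g 0 = 0 ∧ ConcaveOn ℝ (Set.Icc 0 1) g ∧
    ∀ x ∈ Set.Icc (0 : ℝ) 1, ∃ D ∈ Set.Icc L U, HasDerivWithinAt g D (Set.Icc 0 1) x

/-- Valid inputs: admissible price functions, rate constraints in `[0, 1]`, and enough total rate
for the whole asset (of size one) to be sold. -/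
def Input.Valid (L U : ℝ) (I : Input) : Prop :=
  (∀ t, IsPriceFunction L U (I.price t)) ∧ (∀ t, I.rate t ∈ Set.Icc (0 : ℝ) 1) ∧
    1 ≤ ∑ t, I.rate t

/-- The valid inputs in which the compulsory trade cannot begin before step `N`: for every `k < N`
the steps `k + 1, …, T` still have enough total rate for the whole asset. -/
def inputs (L U : ℝ) (N : ℕ) : Set Input :=
  {I | I.Valid L U ∧ ∀ k < N, 1 ≤ ∑ t : Fin I.T with k ≤ t.val, I.rate t}

/-- Feasible solutions: rate constraints and the deadline constraint. -/
def Input.Feasible (I : Input) (x : Fin I.T → ℝ) : Prop :=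
  (∀ t, x t ∈ Set.Icc 0 (I.rate t)) ∧ ∑ t, x t = 1

/-- The decisions `x_1, …, x_T` as a sequence on `ℕ`, with `x_0 = 0` and `x_k = 0` for `k > T`. -/
def pad {T : ℕ} (x : Fin T → ℝ) (k : ℕ) : ℝ :=
  if h : 1 ≤ k ∧ k ≤ T then x ⟨k - 1, by omega⟩ else 0

/-- Selling profit minus switching cost
`∑_{t=1}^{T} g_t(x_t) - ∑_{t=1}^{T+1} β |x_t - x_{t-1}|`. -/
def Input.profit (β : ℝ) (I : Input) (x : Fin I.T → ℝ) : ℝ :=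
  ∑ t, I.price t (x t) - ∑ k ∈ Finset.range (I.T + 1), β * |pad x (k + 1) - pad x k|

/-- The offline optimum. -/
def Input.opt (β : ℝ) (I : Input) : ℝ :=
  sSup {p | ∃ x, I.Feasible x ∧ p = I.profit β x}

/-- A deterministic online policy: the decision at time step `t` depends only on the deadline and
the rate constraints, which are known in advance, and on the price functions revealed so far. -/
abbrev Policy : Type :=
  (T : ℕ) → (rate : Fin T → ℝ) → (t : Fin T) → (revealed : Fin (t.val + 1) → ℝ → ℝ) → ℝ

/-- The decisions of a policy on an input. -/
def Policy.run (A : Policy) (I : Input) : Fin I.T → ℝ :=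
  fun t => A I.T I.rate t fun i => I.price (Fin.castLE t.isLt i)

/-- A policy is an algorithm for the problem if its decisions are feasible on every valid input. -/
def Policy.Solves (L U : ℝ) (A : Policy) : Prop :=
  ∀ I : Input, I.Valid L U → I.Feasible (A.run I)

/-- The competitive ratio `sup OPT(I) / ALG(I)` over the inputs of `inputs L U N`. -/
def Policy.competitiveRatio (L U β : ℝ) (N : ℕ) (A : Policy) : EReal :=
  ⨆ I ∈ inputs L U N, ((I.opt β / I.profit β (A.run I) : ℝ) : EReal)

/-- The principal branch of the Lambert function: the inverse of `w ↦ w e ^ w` on `[-1, ∞)`. -/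
def lambertW : ℝ → ℝ :=
  Function.invFunOn (fun w : ℝ => w * Real.exp w) (Set.Ici (-1))

/-- The ratio `ω`. -/
def omega (L U β : ℝ) : ℝ :=
  lambertW ((U / L - 1 - 2 * β / L) / Real.exp (1 + 2 * β / L)) + 1 + 2 * β / L

end OCSMax

end

noncomputable section

namespace OCSMax

/-! An adversary shows linear prices whose slopes climb a geometric grid from `ωL` to `U`. Each
slope `p` is to appear `m` times in a row, so that the offline optimum can spread its sale and pays
only `2β/m`. The seller must gain nothing from such a run: once a single step carries most of what
was sold at `p`, the run is broken off and `L` is shown until the decision is nearly zero. The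
seller has then paid almost `2β` per unit, so slope `p` is worth only `p - L - 2β` above the base
price. Each interruption consumes a fixed minimum of the asset, so after boundedly many a full run
occurs with negligible sales (`exists_block`, chained in `exists_blocks`).

Filling up with `L` after any run turns a ratio `c < ω` into a lower bound on the weighted sales so
far (`Policy.block_le`). Partial summation over the grid (`one_lt_sum_of_geometric_grid`) then
forces total sales above one, because `(ωL - L - 2β) e^ω = U - L - 2β`. -/

/-- The amount sold along a history of slopes (latest slope first) when the decision after the
history `h` is `X h`. -/
def sold (X : List ℝ → ℝ) : List ℝ → ℝ
  | [] => 0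
  | p :: h => sold X h + X (p :: h)

/-- The revenue along a history, in excess of selling everything at slope `L`. -/
def excess (L : ℝ) (X : List ℝ → ℝ) : List ℝ → ℝ
  | [] => 0
  | p :: h => excess L X h + (p - L) * X (p :: h)

/-- The total variation of the decisions along a history. -/
def variation (X : List ℝ → ℝ) : List ℝ → ℝ
  | [] => 0
  | p :: h => variation X h + |X (p :: h) - X h|

/-- Excess revenue minus switching cost along a history, if the decision drops to zero after it. -/
def surplus (L β : ℝ) (X : List ℝ → ℝ) (h : List ℝ) : ℝ :=
  excess L X h - β * (variation X h + X h)

/-- Histories of length at most `T` with slopes in `[L, U]`. -/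
def Admissible (L U : ℝ) (T : ℕ) (h : List ℝ) : Prop :=
  h.length ≤ T ∧ ∀ p ∈ h, p ∈ Set.Icc L U

/-- A decision rule that is nonnegative and never sells more than one unit. -/
structure IsSeller (L U : ℝ) (T : ℕ) (X : List ℝ → ℝ) : Prop where
  nil : X [] = 0
  nonneg : ∀ h, Admissible L U T h → 0 ≤ X h
  sold_le : ∀ h, Admissible L U T h → sold X h ≤ 1

/-! ### Bookkeeping along slope histories -/

section Histories

variable {L U β : ℝ} {T : ℕ} {X : List ℝ → ℝ}

lemma Admissible.of_append {l h : List ℝ} (hh : Admissible L U T (l ++ h)) :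
    Admissible L U T h :=
  ⟨by have := hh.1; simp at this; omega, fun p hp => hh.2 p (by simp [hp])⟩

lemma Admissible.replicate_append {h : List ℝ} (hh : Admissible L U T h) {p : ℝ}
    (hp : p ∈ Set.Icc L U) {k : ℕ} (hk : h.length + k ≤ T) :
    Admissible L U T (List.replicate k p ++ h) := by
  refine ⟨by simp; omega, fun q hq => ?_⟩
  rcases List.mem_append.1 hq with hq | hq
  · rw [List.eq_of_mem_replicate hq]; exact hp
  · exact hh.2 q hq

lemma variation_append (l h : List ℝ) :
    variation X h + |X (l ++ h) - X h| ≤ variation X (l ++ h) := by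
  induction l with
  | nil => simp
  | cons p l ih =>
    simp only [List.cons_append, variation]
    have := abs_sub_le (X (p :: (l ++ h))) (X (l ++ h)) (X h)
    linarith

/-- The sum `variation + X` already includes the final drop to zero, so by the triangle inequality a
longer history can only increase it: a cost once charged is never refunded. -/
lemma variation_add_le_append (l h : List ℝ) :
    variation X h + X h ≤ variation X (l ++ h) + X (l ++ h) := by
  have h1 := variation_append (X := X) l h
  have h2 := neg_abs_le (X (l ++ h) - X h)
  linarith

lemma excess_replicate_append (p : ℝ) (k : ℕ) (h : List ℝ) :
    excess L X (List.replicate k p ++ h) =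
      excess L X h + (p - L) * (sold X (List.replicate k p ++ h) - sold X h) := by
  induction k with
  | zero => simp
  | succ k ih =>
    simp only [List.replicate_succ, List.cons_append, excess, sold, ih]
    ring

lemma IsSeller.sold_le_append (hX : IsSeller L U T X) {l h : List ℝ}
    (hh : Admissible L U T (l ++ h)) : sold X h ≤ sold X (l ++ h) := by
  induction l with
  | nil => simp
  | cons p l ih =>
    have h1 := hX.nonneg _ hh
    have h2 := ih (Admissible.of_append (l := [p]) hh)
    simp only [List.cons_append, sold] at h1 ⊢
    linarith

lemma IsSeller.variation_add_le (hX : IsSeller L U T X) {h : List ℝ}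
    (hh : Admissible L U T h) : variation X h + X h ≤ 2 * sold X h := by
  induction h with
  | nil => simp [variation, sold, hX.nil]
  | cons p h ih =>
    have hh' := Admissible.of_append (l := [p]) hh
    have h1 := hX.nonneg _ hh
    have h2 := hX.nonneg _ hh'
    have h3 := ih hh'
    simp only [variation, sold]
    have : |X (p :: h) - X h| ≤ X (p :: h) + X h := abs_le.2 ⟨by linarith, by linarith⟩
    linarith

lemma IsSeller.excess_nonneg (hX : IsSeller L U T X) {h : List ℝ}
    (hh : Admissible L U T h) : 0 ≤ excess L X h := by
  induction h with
  | nil => simp [excess]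
  | cons p h ih =>
    have h1 := hX.nonneg _ hh
    have h2 := ih (Admissible.of_append (l := [p]) hh)
    have h3 := (hh.2 p (by simp)).1
    simp only [excess]
    have := mul_nonneg (sub_nonneg.2 h3) h1
    linarith

/-- A nonnegative sequence that returns to zero varies by at most twice its sum. With `2β < L` this
keeps the algorithm's profit positive. -/
lemma IsSeller.neg_le_surplus (hX : IsSeller L U T X) (hβ : 0 ≤ β) {h : List ℝ}
    (hh : Admissible L U T h) : -(2 * β) ≤ surplus L β X h := by
  have h1 := hX.variation_add_le hh
  have h2 := hX.excess_nonneg hh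
  have h3 := hX.sold_le h hh
  have h4 : β * (variation X h + X h) ≤ β * 2 :=
    mul_le_mul_of_nonneg_left (by linarith) hβ
  simp only [surplus]
  linarith

/-- Sales at slope `L` yield no excess; hence neither interruptions nor the final filling with `L`
help the seller. -/
lemma surplus_replicate_low_append_le (hβ : 0 ≤ β) (k : ℕ) (h : List ℝ) :
    surplus L β X (List.replicate k L ++ h) ≤ surplus L β X h := by
  have h1 := mul_le_mul_of_nonneg_left (variation_add_le_append (X := X) (List.replicate k L) h) hβ
  simp only [surplus, excess_replicate_append]
  linarith

/-! ### The adversary's play -/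

/-- While low slopes are shown, the decision becomes small. -/
lemma IsSeller.exists_small (hX : IsSeller L U T X) (hLU : L ≤ U) {l : ℕ} (hl : 0 < l)
    {h : List ℝ} (hh : Admissible L U T h) (hT : h.length + l ≤ T) :
    ∃ j ≤ l, X (List.replicate j L ++ h) ≤ 1 / l := by
  by_contra! hcon
  have key : ∀ j ≤ l, (j : ℝ) * (1 / l) ≤ sold X (List.replicate j L ++ h) - sold X h := by
    intro j hj
    induction j with
    | zero => simp
    | succ j ih =>
      have h1 := ih (by omega)
      have h2 := hcon (j + 1) hj
      simp only [List.replicate_succ, List.cons_append, sold] at h2 ⊢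
      push_cast
      linarith
  have hlR : (0 : ℝ) < l := by exact_mod_cast hl
  have h1 := key l le_rfl
  have h2 := hX.sold_le _ (hh.replicate_append ⟨le_rfl, hLU⟩ hT)
  have h3 : 0 ≤ sold X h := by
    simpa [sold] using hX.sold_le_append (l := h) (h := []) (by simpa using hh)
  -- The `l` low steps only give sales of at least one; the case `j = 0` shows that something was
  -- sold before, which makes the bound strict.
  have h4 := hcon 0 (by omega)
  have h5 : X h ≤ sold X h := by
    cases h with
    | nil => simp [sold, hX.nil]
    | cons p h =>
      have := hX.sold_le_append (l := h) (h := [])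
        (by simpa using Admissible.of_append (l := [p]) hh)
      simp only [List.append_nil, sold] at this ⊢
      linarith
  rw [mul_one_div_cancel hlR.ne'] at h1
  have : 0 < 1 / (l : ℝ) := by positivity
  simp only [List.replicate_zero, List.nil_append] at h4
  linarith

/-- Unless little is sold while the slope `p` is repeated `m` times, there is a repetition at which
most of the amount sold so far is sold at once, and this amount is not too small. -/
lemma exists_dominant_step {γ : ℝ} (hγ : 0 < γ) (hγ1 : γ < 1) (p : ℝ) (h : List ℝ) (m : ℕ)
    {ε : ℝ} (hε : 0 ≤ ε) (hs : ε < sold X (List.replicate m p ++ h) - sold X h) :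
    ∃ j ≤ m, ε * γ ^ m ≤ sold X (List.replicate j p ++ h) - sold X h ∧
      (1 - γ) * (sold X (List.replicate j p ++ h) - sold X h) ≤ X (List.replicate j p ++ h) := by
  induction m generalizing ε with
  | zero => simp at hs; linarith
  | succ m ih =>
    by_cases hc : (1 - γ) * (sold X (List.replicate (m + 1) p ++ h) - sold X h) ≤
        X (List.replicate (m + 1) p ++ h)
    · refine ⟨m + 1, le_rfl, ?_, hc⟩
      have : ε * γ ^ (m + 1) ≤ ε * 1 :=
        mul_le_mul_of_nonneg_left (pow_le_one₀ hγ.le hγ1.le) hε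
      linarith
    · push Not at hc
      have h1 : sold X (List.replicate (m + 1) p ++ h) =
          sold X (List.replicate m p ++ h) + X (List.replicate (m + 1) p ++ h) := rfl
      -- If the last step is not dominant, more than a fraction `γ` of the sales came before it.
      obtain ⟨j, hj, h2, h3⟩ := ih (ε := γ * ε) (by positivity) (by nlinarith)
      exact ⟨j, by omega, by rw [pow_succ]; linarith, h3⟩

/-- The adversary's play at slope `p`, with at most `k` interrupted repetitions of `p`. -/
lemma exists_block_of_fuel (hX : IsSeller L U T X) (hβ : 0 ≤ β) (hLU : L ≤ U) {γ ε : ℝ}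
    (hγ : 0 < γ) (hγ1 : γ < 1) (hε : 0 ≤ ε) {l : ℕ} (hl : 0 < l) {p : ℝ}
    (hp : p ∈ Set.Icc L U) (m k : ℕ) {h : List ℝ} (hh : Admissible L U T h)
    (hT : h.length + k * (l + m) ≤ T) (hk : 1 < sold X h + k * (ε * γ ^ m)) :
    ∃ h' s, Admissible L U T (List.replicate m p ++ h') ∧
      m + h'.length ≤ h.length + k * (l + m) ∧ 0 ≤ s ∧
      sold X h + s ≤ sold X (List.replicate m p ++ h') ∧
      surplus L β X (List.replicate m p ++ h') ≤ surplus L β X h + (p - L - 2 * β) * s +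
        2 * β * (γ * s + ε + k / l) := by
  induction k generalizing h with
  | zero =>
    have := hX.sold_le h hh
    simp at hk
    linarith
  | succ k ih =>
    have hkl : (k + 1) * (l + m) = k * (l + m) + l + m := by ring
    rw [hkl] at hT ⊢
    have hlow : L ∈ Set.Icc L U := ⟨le_rfl, hLU⟩
    obtain ⟨i, hi, hsmall⟩ := hX.exists_small hLU hl hh (by omega)
    set g := List.replicate i L ++ h with hg
    have hgA : Admissible L U T g := hh.replicate_append hlow (by omega)
    have hglen : g.length = i + h.length := by simp [hg]
    have hgsold : sold X h ≤ sold X g := hX.sold_le_append hgA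
    have hgsur : surplus L β X g ≤ surplus L β X h := surplus_replicate_low_append_le hβ i h
    have hk0 : (0 : ℝ) ≤ k / l := by positivity
    have hl0 : (0 : ℝ) ≤ 1 / l := by positivity
    have hadd : ((k + 1 : ℕ) : ℝ) / l = k / l + 1 / l := by push_cast; ring
    -- A full run selling at most `ε` ends the play: the switching cost not charged is at most
    -- `2βε`.
    by_cases hs : sold X (List.replicate m p ++ g) - sold X g ≤ ε
    · have hA := hgA.replicate_append hp (k := m) (by omega)
      have h0 := hX.sold_le_append hA
      refine ⟨g, sold X (List.replicate m p ++ g) - sold X g, hA, by omega, by linarith,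
        by linarith, ?_⟩
      have h1 := mul_le_mul_of_nonneg_left
        (variation_add_le_append (X := X) (List.replicate m p) g) hβ
      have h2 : surplus L β X (List.replicate m p ++ g) ≤ surplus L β X g +
          (p - L) * (sold X (List.replicate m p ++ g) - sold X g) := by
        simp only [surplus, excess_replicate_append]
        linarith
      set S := sold X (List.replicate m p ++ g) - sold X g
      have h3 : β * S ≤ β * (γ * S + ε + (k / l + 1 / l)) := by
        refine mul_le_mul_of_nonneg_left ?_ hβ
        have : 0 ≤ γ * S := mul_nonneg hγ.le (by linarith)
        linarith
      rw [hadd]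
      linarith
    · push Not at hs
      obtain ⟨j, hj, hj1, hj2⟩ := exists_dominant_step hγ hγ1 p g m hε hs
      have hA := hgA.replicate_append hp (k := j) (by omega)
      have hlen : (List.replicate j p ++ g).length = j + i + h.length := by simp [hglen]; omega
      push_cast at hk
      obtain ⟨h', s, h'1, h'2, h'3, h'4, h'5⟩ := ih hA (by omega) (by linarith)
      have h0 := hX.sold_le_append hA
      refine ⟨h', sold X (List.replicate j p ++ g) - sold X g + s, h'1, by omega, by linarith,
        by linarith, ?_⟩
      have h1 := variation_append (X := X) (List.replicate j p) g
      have h2 := le_abs_self (X (List.replicate j p ++ g) - X g)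
      set S := sold X (List.replicate j p ++ g) - sold X g with hS
      -- The decision rises from at most `1/l` to at least `(1 - γ) S` and must come down again, so
      -- both directions are charged.
      have h3 : β * (2 * ((1 - γ) * S) - 2 * (1 / l)) ≤
          β * (variation X (List.replicate j p ++ g) + X (List.replicate j p ++ g) -
            (variation X g + X g)) :=
        mul_le_mul_of_nonneg_left (by linarith) hβ
      have h4 : surplus L β X (List.replicate j p ++ g) = surplus L β X g + (p - L) * S -
          β * (variation X (List.replicate j p ++ g) + X (List.replicate j p ++ g) -
            (variation X g + X g)) := by
        simp only [surplus, excess_replicate_append, hS]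
        ring
      rw [hadd]
      linarith

end Histories

/-- The adversary's play at slope `p`: with bounded delay, `p` can be shown `m` times in a row so
that the seller, up to a small error, has paid the full switching cost for all sales at `p`. -/
lemma exists_block {β e : ℝ} (hβ : 0 < β) (he : 0 < e) (m : ℕ) :
    ∃ Λ : ℕ, ∀ (L U : ℝ) (T : ℕ) (X : List ℝ → ℝ), L ≤ U → IsSeller L U T X →
      ∀ p ∈ Set.Icc L U, ∀ h, Admissible L U T h → h.length + Λ ≤ T →
      ∃ h' s, Admissible L U T (List.replicate m p ++ h') ∧
        m + h'.length ≤ h.length + Λ ∧ 0 ≤ s ∧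
        sold X h + s ≤ sold X (List.replicate m p ++ h') ∧
        surplus L β X (List.replicate m p ++ h') ≤
          surplus L β X h + (p - L - 2 * β) * s + e := by
  -- The three error terms, from `γ`, `ε` and `K / l`, get `e / 3` each; `K` interruptions would
  -- exhaust the asset.
  obtain ⟨γ, hγ, hγ1, hγe⟩ : ∃ γ : ℝ, 0 < γ ∧ γ < 1 ∧ 2 * β * γ ≤ e / 3 := by
    refine ⟨min (1 / 2) (e / (6 * β)), by positivity, by
      exact (min_le_left _ _).trans_lt (by norm_num), ?_⟩
    calc 2 * β * min (1 / 2) (e / (6 * β)) ≤ 2 * β * (e / (6 * β)) := by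
          gcongr; exact min_le_right _ _
      _ = e / 3 := by field_simp; norm_num
  set ε := e / (6 * β) with hε
  have hε0 : 0 < ε := by positivity
  have hεe : 2 * β * ε = e / 3 := by rw [hε]; field_simp; norm_num
  obtain ⟨K, hK⟩ := exists_nat_gt (1 / (ε * γ ^ m))
  have hK1 : 1 < K * (ε * γ ^ m) := by rwa [div_lt_iff₀ (by positivity)] at hK
  obtain ⟨l, hl⟩ := exists_nat_gt (6 * β * K / e)
  have hlR : (0 : ℝ) < l := lt_of_le_of_lt (by positivity) hl
  have hle : 2 * β * (K / l) ≤ e / 3 := by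
    rw [div_lt_iff₀ he] at hl
    rw [← mul_div_assoc, div_le_iff₀ hlR]
    linarith
  -- The delay must not depend on `T` or `X`, since a policy knows `T` and its decision rule varies
  -- with it.
  refine ⟨K * (l + m), fun L U T X hLU hX p hp h hh hT => ?_⟩
  have hs0 : 0 ≤ sold X h := by
    simpa [sold] using hX.sold_le_append (l := h) (h := []) (by simpa using hh)
  obtain ⟨h', s, h1, h2, h3, h4, h5⟩ := exists_block_of_fuel hX hβ.le hLU hγ hγ1 hε0.le
    (by exact_mod_cast hlR : 0 < l) hp m K hh hT (by linarith)
  refine ⟨h', s, h1, h2, h3, h4, h5.trans ?_⟩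
  have hs1 : s ≤ 1 := by linarith [hX.sold_le _ h1]
  have : 2 * β * γ * s ≤ 2 * β * γ * 1 := by gcongr
  linarith

/-- The play through the slopes `p 0, …, p (n - 1)`. -/
lemma exists_blocks {β e : ℝ} (hβ : 0 < β) (he : 0 < e) (m n : ℕ) :
    ∃ T₀ : ℕ, ∀ (L U : ℝ) (T : ℕ) (X : List ℝ → ℝ), T₀ ≤ T → L ≤ U → IsSeller L U T X →
      ∀ p : ℕ → ℝ, (∀ i < n, p i ∈ Set.Icc L U) →
      ∃ (h : ℕ → List ℝ) (s : ℕ → ℝ), ∑ i ∈ Finset.range n, s i ≤ 1 ∧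
        ∀ i < n, Admissible L U T (List.replicate m (p i) ++ h i) ∧
          surplus L β X (List.replicate m (p i) ++ h i) ≤
            ∑ k ∈ Finset.range (i + 1), (p k - L - 2 * β) * s k + (i + 1) * e := by
  obtain ⟨Λ, hΛ⟩ := exists_block hβ he m
  refine ⟨n * Λ, fun L U T X hT hLU hX p hp => ?_⟩
  have key : ∀ (i : ℕ) (g : List ℝ), ∃ (h' : List ℝ) (s : ℝ), i < n → Admissible L U T g →
      g.length + Λ ≤ T → Admissible L U T (List.replicate m (p i) ++ h') ∧
        m + h'.length ≤ g.length + Λ ∧ 0 ≤ s ∧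
        sold X g + s ≤ sold X (List.replicate m (p i) ++ h') ∧
        surplus L β X (List.replicate m (p i) ++ h') ≤
          surplus L β X g + (p i - L - 2 * β) * s + e := by
    intro i g
    by_cases hc : i < n ∧ Admissible L U T g ∧ g.length + Λ ≤ T
    · obtain ⟨h', s, H⟩ := hΛ L U T X hLU hX (p i) (hp i hc.1) g hc.2.1 hc.2.2
      exact ⟨h', s, fun _ _ _ => H⟩
    -- Dummy values make the choice total, so that the histories can be defined by plain recursion.
    · exact ⟨[], 0, fun a b c => absurd ⟨a, b, c⟩ hc⟩
  choose F S hFS using key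
  let G : ℕ → List ℝ := fun i => Nat.rec [] (fun i g => List.replicate m (p i) ++ F i g) i
  have hG : ∀ i, G (i + 1) = List.replicate m (p i) ++ F i (G i) := fun _ => rfl
  have inv : ∀ i ≤ n, Admissible L U T (G i) ∧ (G i).length ≤ i * Λ ∧
      ∑ k ∈ Finset.range i, S k (G k) ≤ sold X (G i) ∧
      surplus L β X (G i) ≤
        ∑ k ∈ Finset.range i, (p k - L - 2 * β) * S k (G k) + i * e := by
    intro i hi
    induction i with
    | zero =>
      simp [G, Admissible, sold, surplus, excess, variation, hX.nil]
    | succ i ih =>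
      obtain ⟨h1, h2, h3, h4⟩ := ih (by omega)
      have hlen : (i + 1) * Λ ≤ T := (Nat.mul_le_mul_right Λ hi).trans hT
      have hsucc : (i + 1) * Λ = i * Λ + Λ := by ring
      obtain ⟨a1, a2, -, a4, a5⟩ := hFS i (G i) (by omega) h1 (by omega)
      rw [← hG] at a1 a4 a5
      refine ⟨a1, by rw [hG]; simp; omega, ?_, ?_⟩
      · rw [Finset.sum_range_succ]; linarith
      · rw [Finset.sum_range_succ]; push_cast; linarith
  refine ⟨fun i => F i (G i), fun i => S i (G i), ?_, fun i hi => ?_⟩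
  · exact (inv n le_rfl).2.2.1.trans (hX.sold_le _ (inv n le_rfl).1)
  · obtain ⟨h1, -, -, h4⟩ := inv (i + 1) hi
    rw [hG] at h1 h4
    exact ⟨h1, by simpa using h4⟩


/-! ### The geometric grid and the equation for `ω` -/

/-- Weights on a geometric grid whose partial weighted sums dominate an affine function of the grid
points have a large total. -/
lemma one_lt_sum_of_geometric_grid {q₀ r b c : ℝ} (hr : 1 ≤ r) (hq₀ : 0 ≤ q₀) (hb : 0 < b)
    (hc : 0 < c) {s : ℕ → ℝ} {n : ℕ} (hn : c ≤ n * (1 - 1 / r))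
    (h : ∀ i ≤ n, b + (q₀ * r ^ i - q₀) / c ≤ ∑ k ∈ Finset.range (i + 1), q₀ * r ^ k * s k) :
    1 < ∑ k ∈ Finset.range (n + 1), s k := by
  have hr0 : 0 < r := by linarith
  have hq : 0 < q₀ := by
    rcases hq₀.lt_or_eq with hq | hq
    · exact hq
    · have := h 0 (Nat.zero_le _)
      simp [← hq] at this
      linarith
  set A : ℕ → ℝ := fun i => ∑ k ∈ Finset.range (i + 1), q₀ * r ^ k * s k with hA
  set B : ℕ → ℝ := fun i => b + (q₀ * r ^ i - q₀) / c with hB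
  -- Partial summation: were `A = B`, the weights would sum to the first two terms. The slack `A i -
  -- B i` is nonnegative and is divided by nondecreasing grid points.
  have key : ∀ i ≤ n, b / q₀ + i / c * (1 - 1 / r) + (A i - B i) / (q₀ * r ^ i) ≤
      ∑ k ∈ Finset.range (i + 1), s k := by
    intro i hi
    induction i with
    | zero =>
      simp only [hA, hB]
      simp
      field_simp
      linarith
    | succ i ih =>
      rw [Finset.sum_range_succ]
      have h1 := ih (by omega)
      have h2 : A (i + 1) = A i + q₀ * r ^ (i + 1) * s (i + 1) := Finset.sum_range_succ _ _
      have h3 : 0 ≤ (A i - B i) * (1 / (q₀ * r ^ i) - 1 / (q₀ * r ^ (i + 1))) := by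
        refine mul_nonneg (sub_nonneg.2 (h i (by omega))) (sub_nonneg.2 ?_)
        refine one_div_le_one_div_of_le (by positivity) ?_
        exact mul_le_mul_of_nonneg_left (pow_le_pow_right₀ hr (Nat.le_succ i)) hq₀
      have h4 : B (i + 1) = B i + (q₀ * r ^ (i + 1) - q₀ * r ^ i) / c := by
        simp only [hB]; ring
      have h5 : (A (i + 1) - B (i + 1)) / (q₀ * r ^ (i + 1)) =
          (A i - B i) / (q₀ * r ^ (i + 1)) + s (i + 1) - (1 - 1 / r) / c := by
        rw [h2, h4]
        field_simp
        ring
      rw [h5]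
      have h6 : (A i - B i) * (1 / (q₀ * r ^ i) - 1 / (q₀ * r ^ (i + 1))) =
          (A i - B i) / (q₀ * r ^ i) - (A i - B i) / (q₀ * r ^ (i + 1)) := by ring
      have h7 : ((i + 1 : ℕ) : ℝ) / c * (1 - 1 / r) =
          i / c * (1 - 1 / r) + (1 - 1 / r) / c := by push_cast; ring
      rw [h7]
      linarith
  have h1 := key n le_rfl
  have h2 : 0 ≤ (A n - B n) / (q₀ * r ^ n) :=
    div_nonneg (sub_nonneg.2 (h n le_rfl)) (by positivity)
  have h3 : 1 ≤ n / c * (1 - 1 / r) := by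
    rw [div_mul_eq_mul_div, one_le_div hc]; exact hn
  have h4 : 0 < b / q₀ := by positivity
  linarith

lemma lambertW_spec {y : ℝ} (hy : 0 ≤ y) :
    0 ≤ lambertW y ∧ lambertW y * Real.exp (lambertW y) = y := by
  have hex : ∃ w ∈ Set.Ici (-1 : ℝ), w * Real.exp w = y := by
    have hivt := intermediate_value_Icc hy
      (f := fun w : ℝ => w * Real.exp w) (by fun_prop)
    obtain ⟨w, hw, hwy⟩ := hivt (show y ∈ Set.Icc _ _ from
      ⟨by simpa using hy, le_mul_of_one_le_right hy (Real.one_le_exp hy)⟩)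
    exact ⟨w, by have := hw.1; simp only [Set.mem_Ici]; linarith, hwy⟩
  have heq : lambertW y * Real.exp (lambertW y) = y := Function.invFunOn_eq hex
  refine ⟨?_, heq⟩
  by_contra! hneg
  have := mul_neg_of_neg_of_pos hneg (Real.exp_pos (lambertW y))
  linarith

/-- These two facts let a grid of ratio `e^(ω/n)` for the slope minus `L + 2β` lead from slope `ωL`
to slope `U` in `n` steps. -/
lemma omega_spec {L U β : ℝ} (hL : 0 < L) (hU : 2 * β ≤ U - L) :
    L + 2 * β ≤ omega L U β * L ∧
      (omega L U β * L - L - 2 * β) * Real.exp (omega L U β) = U - L - 2 * β := by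
  have hy : 0 ≤ (U / L - 1 - 2 * β / L) / Real.exp (1 + 2 * β / L) := by
    refine div_nonneg ?_ (Real.exp_pos _).le
    have : U / L - 1 - 2 * β / L = (U - L - 2 * β) / L := by field_simp
    rw [this]
    exact div_nonneg (by linarith) hL.le
  obtain ⟨h0, h1⟩ := lambertW_spec hy
  have h2 : omega L U β * L - L - 2 * β =
      L * lambertW ((U / L - 1 - 2 * β / L) / Real.exp (1 + 2 * β / L)) := by
    rw [omega]; field_simp; ring
  have h3 : Real.exp (omega L U β) =
      Real.exp (lambertW ((U / L - 1 - 2 * β / L) / Real.exp (1 + 2 * β / L))) *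
        Real.exp (1 + 2 * β / L) := by
    rw [← Real.exp_add, omega]; ring_nf
  refine ⟨by have := mul_nonneg hL.le h0; linarith, ?_⟩
  rw [h2, h3, mul_assoc, ← mul_assoc (lambertW _), h1,
    div_mul_cancel₀ _ (Real.exp_pos _).ne']
  field_simp

/-- The right side tends to `w` as the grid is refined; `e^x ≥ 1 + x` bounds it below by `nw / (w +
n)`. -/
lemma exists_le_mul_one_sub_exp {c w : ℝ} (hc : 0 < c) (hcw : c < w) :
    ∃ n : ℕ, 0 < n ∧ c ≤ n * (1 - 1 / Real.exp (w / n)) := by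
  obtain ⟨n, hn⟩ := exists_nat_gt (c * w / (w - c))
  have hw : 0 < w := hc.trans hcw
  have hwc : 0 < w - c := by linarith
  have hn0 : (0 : ℝ) < n := lt_of_le_of_lt (by positivity) hn
  refine ⟨n, by exact_mod_cast hn0, ?_⟩
  rw [div_lt_iff₀ hwc] at hn
  have h1 : 1 / Real.exp (w / n) ≤ 1 / (w / n + 1) :=
    one_div_le_one_div_of_le (by positivity) (Real.add_one_le_exp _)
  calc c ≤ n * (1 - 1 / (w / n + 1)) := by
        have : (n : ℝ) * (1 - 1 / (w / n + 1)) = n * w / (w + n) := by field_simp; ring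
        rw [this, le_div_iff₀ (by positivity)]
        linarith
    _ ≤ _ := by gcongr


/-! ### Linear inputs and policies as sellers -/

/-- The input of length `T` with linear price functions of slopes `u 0, …, u (T - 1)` and without
rate restrictions. -/
def linearInput (T : ℕ) (u : ℕ → ℝ) : Input where
  T := T
  price t x := u t * x
  rate _ := 1

/-- The slopes recorded in a history, in chronological order, continued by the constant `L`. -/
def slopes (L : ℝ) (h : List ℝ) (t : ℕ) : ℝ := h.reverse.getD t L

/-- The decision of a policy after a history of slopes. -/
def Policy.decision (L : ℝ) (T : ℕ) (A : Policy) (h : List ℝ) : ℝ :=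
  pad (A.run (linearInput T (slopes L h))) h.length

variable {L U β : ℝ} {T : ℕ}

lemma isPriceFunction_linear {a : ℝ} (ha : a ∈ Set.Icc L U) :
    IsPriceFunction L U (fun x => a * x) := by
  refine ⟨by simp, ?_, fun x _ => ⟨a, ha, ?_⟩⟩
  · exact (LinearMap.mulLeft ℝ a).concaveOn (convex_Icc 0 1)
  · simpa using ((hasDerivAt_id x).const_mul a).hasDerivWithinAt

/-- Any single remaining step can absorb the whole asset. -/
lemma linearInput_mem_inputs {u : ℕ → ℝ} (hu : ∀ t, u t ∈ Set.Icc L U) {N : ℕ} (hN : N < T) :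
    linearInput T u ∈ inputs L U N := by
  have hsum : ∀ k < T, (1 : ℝ) ≤ ∑ t : Fin T with k ≤ t.val, (1 : ℝ) := fun k hk =>
    Finset.single_le_sum (f := fun _ : Fin T => (1 : ℝ)) (fun _ _ => zero_le_one)
      (a := ⟨k, hk⟩) (by simp)
  refine ⟨⟨fun t => isPriceFunction_linear (hu t), fun t => ⟨zero_le_one, le_rfl⟩, ?_⟩,
    fun k hk => hsum k (hk.trans hN)⟩
  have h := hsum 0 (by omega)
  rwa [Finset.filter_true_of_mem (by simp)] at h

lemma slopes_mem (hLU : L ≤ U) {h : List ℝ} (hh : ∀ p ∈ h, p ∈ Set.Icc L U) (t : ℕ) :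
    slopes L h t ∈ Set.Icc L U := by
  unfold slopes
  by_cases ht : t < h.reverse.length
  · rw [List.getD_eq_getElem _ _ ht]
    exact hh _ (List.mem_reverse.1 (List.getElem_mem ht))
  · rw [List.getD_eq_default _ _ (by omega)]
    exact ⟨le_rfl, hLU⟩

lemma slopes_append (l h : List ℝ) {t : ℕ} (ht : t < h.length) :
    slopes L (l ++ h) t = slopes L h t := by
  unfold slopes
  rw [List.reverse_append, List.getD_append _ _ _ _ (by simpa using ht)]

lemma slopes_replicate_append (p : ℝ) (m : ℕ) (h : List ℝ) {t : ℕ} (ht : h.length ≤ t)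
    (htm : t < h.length + m) : slopes L (List.replicate m p ++ h) t = p := by
  unfold slopes
  rw [List.reverse_append, List.getD_append_right _ _ _ _ (by simpa using ht),
    List.getD_eq_getElem _ _ (by simp; omega)]
  simp

lemma slopes_cons_length (p : ℝ) (h : List ℝ) : slopes L (p :: h) h.length = p :=
  slopes_replicate_append p 1 h le_rfl (by omega)

/-- This is the online property: the deadline and the unit rates reveal nothing about later slopes,
so decisions are functions of the history. -/
lemma Policy.pad_run_congr (A : Policy) {u v : ℕ → ℝ} {k : ℕ} (huv : ∀ t < k, u t = v t) :
    pad (A.run (linearInput T u)) k = pad (A.run (linearInput T v)) k := by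
  change pad (T := T) (fun t => A T (fun _ => 1) t fun i x => u i * x) k =
    pad (T := T) (fun t => A T (fun _ => 1) t fun i x => v i * x) k
  unfold pad
  by_cases hk : 1 ≤ k ∧ k ≤ T
  · rw [dif_pos hk, dif_pos hk]
    dsimp only
    congr 1
    funext i x
    rw [huv]
    have := i.isLt
    omega
  · rw [dif_neg hk, dif_neg hk]

lemma pad_zero (x : Fin T → ℝ) : pad x 0 = 0 := by simp [pad]

lemma pad_eq_zero_of_lt (x : Fin T → ℝ) {k : ℕ} (hk : T < k) : pad x k = 0 :=
  dif_neg (by omega)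

lemma pad_succ (x : Fin T → ℝ) (t : Fin T) : pad x (t + 1) = x t := by
  unfold pad
  rw [dif_pos (by omega)]
  rfl

lemma Policy.decision_eq (A : Policy) {h : List ℝ} {u : ℕ → ℝ}
    (hu : ∀ t < h.length, slopes L h t = u t) :
    A.decision L T h = pad (A.run (linearInput T u)) h.length :=
  A.pad_run_congr hu

lemma Policy.sold_decision (A : Policy) {h : List ℝ} {u : ℕ → ℝ}
    (hu : ∀ t < h.length, slopes L h t = u t) :
    sold (A.decision L T) h =
      ∑ k ∈ Finset.range h.length, pad (A.run (linearInput T u)) (k + 1) := by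
  induction h with
  | nil => simp [sold]
  | cons p h ih =>
    rw [sold, A.decision_eq hu, List.length_cons, Finset.sum_range_succ, ih]
    intro t ht
    rw [← hu t (by simp; omega)]
    exact (slopes_append [p] h ht).symm

lemma Policy.excess_decision (A : Policy) {h : List ℝ} {u : ℕ → ℝ}
    (hu : ∀ t < h.length, slopes L h t = u t) :
    excess L (A.decision L T) h =
      ∑ k ∈ Finset.range h.length, (u k - L) * pad (A.run (linearInput T u)) (k + 1) := by
  induction h with
  | nil => simp [excess]
  | cons p h ih =>
    rw [excess, A.decision_eq hu, List.length_cons, Finset.sum_range_succ, ih,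
      ← hu h.length (by simp), slopes_cons_length]
    intro t ht
    rw [← hu t (by simp; omega)]
    exact (slopes_append [p] h ht).symm

lemma Policy.variation_decision (A : Policy) {h : List ℝ} {u : ℕ → ℝ}
    (hu : ∀ t < h.length, slopes L h t = u t) :
    variation (A.decision L T) h = ∑ k ∈ Finset.range h.length,
      |pad (A.run (linearInput T u)) (k + 1) - pad (A.run (linearInput T u)) k| := by
  induction h with
  | nil => simp [variation]
  | cons p h ih =>
    have hu' : ∀ t < h.length, slopes L h t = u t := by
      intro t ht
      rw [← hu t (by simp; omega)]
      exact (slopes_append [p] h ht).symm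
    rw [variation, A.decision_eq hu, A.decision_eq hu', List.length_cons,
      Finset.sum_range_succ, ih hu']

lemma sum_pad (x : Fin T → ℝ) : ∑ k ∈ Finset.range T, pad x (k + 1) = ∑ t, x t := by
  rw [Finset.sum_range]
  exact Finset.sum_congr rfl fun t _ => pad_succ x t

lemma Policy.isSeller {A : Policy} (hA : A.Solves L U) (hLU : L ≤ U) (hT : 0 < T) :
    IsSeller L U T (A.decision L T) := by
  have hfeas : ∀ h, Admissible L U T h →
      (linearInput T (slopes L h)).Feasible (A.run (linearInput T (slopes L h))) :=
    fun h hh => hA _ (linearInput_mem_inputs (slopes_mem hLU hh.2) (N := 0) hT).1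
  have hpad : ∀ h, Admissible L U T h → ∀ k,
      0 ≤ pad (A.run (linearInput T (slopes L h))) k := by
    intro h hh k
    unfold pad
    split_ifs with hk
    · exact ((hfeas h hh).1 _).1
    · exact le_rfl
  refine ⟨pad_zero _, fun h hh => hpad h hh _, fun h hh => ?_⟩
  rw [A.sold_decision (u := slopes L h) (fun _ _ => rfl)]
  calc _ ≤ ∑ k ∈ Finset.range T, pad (A.run (linearInput T (slopes L h))) (k + 1) :=
        Finset.sum_le_sum_of_subset_of_nonneg (Finset.range_mono hh.1)
          fun k _ _ => hpad h hh _
    _ = 1 := (sum_pad _).trans (hfeas h hh).2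

lemma Policy.profit_run {A : Policy} (hA : A.Solves L U) (hLU : L ≤ U) (hT : 0 < T)
    {h : List ℝ} (hh : Admissible L U T h) (hlen : h.length = T) :
    (linearInput T (slopes L h)).profit β (A.run (linearInput T (slopes L h))) =
      L + surplus L β (A.decision L T) h := by
  have hfeas := hA _ (linearInput_mem_inputs (slopes_mem hLU hh.2) (N := 0) hT).1
  set x := A.run (linearInput T (slopes L h)) with hx
  have hu : ∀ t < h.length, slopes L h t = slopes L h t := fun _ _ => rfl
  have hsum : ∑ k ∈ Finset.range T, pad x (k + 1) = 1 := (sum_pad x).trans hfeas.2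
  have hprice : ∑ t, (linearInput T (slopes L h)).price t (x t) =
      ∑ k ∈ Finset.range T, slopes L h k * pad x (k + 1) := by
    rw [Finset.sum_range]
    exact Finset.sum_congr rfl fun t _ => by rw [pad_succ x t]; rfl
  have hvar : ∑ k ∈ Finset.range ((linearInput T (slopes L h)).T + 1),
      |pad x (k + 1) - pad x k| =
        ∑ k ∈ Finset.range T, |pad x (k + 1) - pad x k| + pad x T := by
    have h0 : 0 ≤ pad x T := by
      unfold pad
      split_ifs with hk
      · exact (hfeas.1 _).1
      · exact le_rfl
    change ∑ k ∈ Finset.range (T + 1), _ = _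
    rw [Finset.sum_range_succ, pad_eq_zero_of_lt x (show (linearInput T (slopes L h)).T < T + 1
      from Nat.lt_succ_self T), zero_sub, abs_neg, abs_of_nonneg h0]
  have hprofit : (linearInput T (slopes L h)).profit β x =
      ∑ t, (linearInput T (slopes L h)).price t (x t) -
        ∑ k ∈ Finset.range ((linearInput T (slopes L h)).T + 1),
          β * |pad x (k + 1) - pad x k| := rfl
  rw [hprofit, hprice, ← Finset.mul_sum, hvar, surplus, A.excess_decision hu,
    A.variation_decision hu, A.decision_eq hu, hlen, ← hx]
  simp only [sub_mul, Finset.sum_sub_distrib, ← Finset.mul_sum, hsum]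
  ring

/-! ### The offline optimum and the ratio -/

lemma profit_le (hβ : 0 ≤ β) {u : ℕ → ℝ} (hu : ∀ t, u t ≤ U) {x : Fin T → ℝ}
    (hx : (linearInput T u).Feasible x) : (linearInput T u).profit β x ≤ U := by
  have h1 : ∑ t, (linearInput T u).price t (x t) ≤ ∑ t, U * x t :=
    Finset.sum_le_sum fun t _ => mul_le_mul_of_nonneg_right (hu t) (hx.1 t).1
  have hx2 : ∑ t, x t = 1 := hx.2
  rw [← Finset.mul_sum, hx2, mul_one] at h1
  have h2 : 0 ≤ ∑ k ∈ Finset.range ((linearInput T u).T + 1),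
      β * |pad (T := (linearInput T u).T) x (k + 1) - pad (T := (linearInput T u).T) x k| :=
    Finset.sum_nonneg fun k _ => mul_nonneg hβ (abs_nonneg _)
  exact (sub_le_self _ h2).trans h1

/-- Selling evenly over `m` consecutive steps of slope `p`. -/
lemma le_opt_of_block (hβ : 0 ≤ β) {u : ℕ → ℝ} (hu : ∀ t, u t ≤ U) {p : ℝ} {a m : ℕ}
    (hm : 0 < m) (ham : a + m ≤ T) (hp : ∀ t, a ≤ t → t < a + m → u t = p) :
    p - 2 * β / m ≤ (linearInput T u).opt β := by
  have hmR : (0 : ℝ) < m := by exact_mod_cast hm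
  have hm1 : (1 : ℝ) ≤ m := by exact_mod_cast hm
  set y : ℕ → ℝ := fun t => if t ∈ Finset.Ico a (a + m) then 1 / (m : ℝ) else 0 with hy
  let x : Fin T → ℝ := fun t => y t
  have hsub : Finset.Ico a (a + m) ⊆ Finset.range T := by
    intro t ht
    rw [Finset.mem_Ico] at ht
    rw [Finset.mem_range]
    omega
  have hsum : ∀ f : ℕ → ℝ, ∑ t : Fin T, f t * x t =
      ∑ t ∈ Finset.Ico a (a + m), f t * (1 / m) := by
    intro f
    rw [← Finset.sum_range (fun t => f t * y t), ← Finset.sum_subset hsub]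
    · exact Finset.sum_congr rfl fun t ht => by rw [hy]; simp only [ht, if_true]
    · intro t _ ht
      simp only [hy, ht, if_false, mul_zero]
  have hfeas : (linearInput T u).Feasible x := by
    refine ⟨fun t => ?_, ?_⟩
    · simp only [x, hy, linearInput]
      split_ifs
      · exact ⟨by positivity, by rw [div_le_one hmR]; exact hm1⟩
      · exact ⟨le_rfl, zero_le_one⟩
    · have := hsum fun _ => 1
      simp only [one_mul] at this
      refine this.trans ?_
      simp [hmR.ne']
  have hprice : ∑ t, (linearInput T u).price t (x t) = p := by
    refine (hsum u).trans ?_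
    rw [Finset.sum_congr rfl fun t ht => by
      rw [hp t (Finset.mem_Ico.1 ht).1 (Finset.mem_Ico.1 ht).2]]
    simp
    field_simp
  have hpad : ∀ k, pad x k = if a < k ∧ k ≤ a + m then 1 / (m : ℝ) else 0 := by
    intro k
    unfold pad
    by_cases hk : 1 ≤ k ∧ k ≤ T
    · rw [dif_pos hk]
      simp only [x, hy, Finset.mem_Ico]
      congr 1
      simp only [eq_iff_iff]
      omega
    · rw [dif_neg hk, if_neg (by omega)]
  -- The padded solution jumps only at `k = a` and `k = a + m`, by `1/m` each time.
  have hvar : ∑ k ∈ Finset.range (T + 1), β * |pad x (k + 1) - pad x k| ≤ 2 * β / m := by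
    calc ∑ k ∈ Finset.range (T + 1), β * |pad x (k + 1) - pad x k|
        ≤ ∑ k ∈ Finset.range (T + 1),
            ((if k = a then β / m else 0) + if k = a + m then β / m else 0) := by
          refine Finset.sum_le_sum fun k _ => ?_
          have hpos : 0 ≤ β / (m : ℝ) := by positivity
          rw [hpad, hpad]
          split_ifs <;> first
            | omega
            | (simp; done)
            | simp [div_eq_mul_inv]
      _ ≤ 2 * β / m := by
          rw [Finset.sum_add_distrib, Finset.sum_ite_eq', Finset.sum_ite_eq',
            if_pos (by simp; omega), if_pos (by simp; omega)]
          exact le_of_eq (by ring)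
  have hprofit : p - 2 * β / m ≤ (linearInput T u).profit β x := by
    have heq : (linearInput T u).profit β x = ∑ t, (linearInput T u).price t (x t) -
        ∑ k ∈ Finset.range (T + 1), β * |pad x (k + 1) - pad x k| := rfl
    rw [heq, hprice]
    exact sub_le_sub_left hvar p
  refine hprofit.trans (le_csSup ⟨U, ?_⟩ ⟨x, hfeas, rfl⟩)
  rintro _ ⟨z, hz, rfl⟩
  exact profit_le hβ hu hz

/-- What a competitive ratio at most `c` means at the end of a block of `m` slopes `p`. -/
lemma Policy.block_le {A : Policy} (hA : A.Solves L U) (hβ : 0 ≤ β) (hβL : β < L / 2)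
    (hLU : L ≤ U) {N m : ℕ} (hN : N < T) (hm : 0 < m) {c : ℝ} (hc : 0 ≤ c)
    (hratio : A.competitiveRatio L U β N ≤ c) {p : ℝ} {h : List ℝ}
    (hh : Admissible L U T (List.replicate m p ++ h)) :
    p - 2 * β / m ≤ c * (L + surplus L β (A.decision L T) (List.replicate m p ++ h)) := by
  have hT : 0 < T := by omega
  set g := List.replicate m p ++ h with hg
  set f := List.replicate (T - g.length) L ++ g with hf
  have hglen : g.length = m + h.length := by simp [hg]
  have hle := hh.1
  have hfA : Admissible L U T f := hh.replicate_append ⟨le_rfl, hLU⟩ (by omega)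
  have hflen : f.length = T := by simp only [hf, List.length_append, List.length_replicate]; omega
  have hprofit := A.profit_run (β := β) hA hLU hT hfA hflen
  have hpos : 0 < L + surplus L β (A.decision L T) f := by
    have := (A.isSeller hA hLU hT).neg_le_surplus hβ hfA
    linarith
  have hsur : surplus L β (A.decision L T) f ≤ surplus L β (A.decision L T) g :=
    surplus_replicate_low_append_le hβ _ g
  have hopt : p - 2 * β / m ≤ (linearInput T (slopes L f)).opt β := by
    refine le_opt_of_block hβ (fun t => (slopes_mem hLU hfA.2 t).2) hm (a := h.length)
      (by omega) fun t h1 h2 => ?_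
    rw [hf, slopes_append _ _ (by omega), hg, slopes_replicate_append p m h h1 h2]
  have hdiv : (linearInput T (slopes L f)).opt β /
      (linearInput T (slopes L f)).profit β (A.run (linearInput T (slopes L f))) ≤ c := by
    have hmem : linearInput T (slopes L f) ∈ inputs L U N :=
      linearInput_mem_inputs (slopes_mem hLU hfA.2) hN
    have := (le_iSup₂ (f := fun (I : Input) (_ : I ∈ inputs L U N) =>
      ((I.opt β / I.profit β (A.run I) : ℝ) : EReal)) _ hmem).trans hratio
    exact_mod_cast this
  rw [hprofit, div_le_iff₀ hpos] at hdiv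
  have := mul_le_mul_of_nonneg_left hsur hc
  linarith

end OCSMax

end

/-! ### The lower bound -/

theorem theoremC3 (L U β : ℝ) (hL : 0 < L) (hβ : 0 < β) (hβL : β < L / 2)
    (hβU : β ≤ (U - L) / 2) (N : ℕ) (A : OCSMax.Policy) (hA : A.Solves L U) :
    (OCSMax.omega L U β : EReal) ≤ A.competitiveRatio L U β N := by
  open OCSMax in
  by_contra! hlt
  obtain ⟨hω1, hω2⟩ := omega_spec (L := L) (U := U) (β := β) hL (by linarith)
  set w := omega L U β with hw
  have hLU : L ≤ U := by linarith
  obtain ⟨c, hc0, hcw, hratio⟩ :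
      ∃ c : ℝ, 0 < c ∧ c < w ∧ A.competitiveRatio L U β N ≤ c := by
    obtain ⟨c, h1, h2⟩ := EReal.lt_iff_exists_real_btwn.1 hlt
    have hw1 : 1 < w := by
      by_contra! hle
      have := mul_le_mul_of_nonneg_right hle hL.le
      linarith
    -- The maximum with `1` guarantees a positive `c`.
    exact ⟨max c 1, by positivity, max_lt (by exact_mod_cast h2) hw1,
      h1.le.trans (by exact_mod_cast le_max_left c 1)⟩
  obtain ⟨n, hn0, hn⟩ := exists_le_mul_one_sub_exp hc0 hcw
  have hn0R : (0 : ℝ) < n := by exact_mod_cast hn0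
  have hgap : 0 < w * L - c * L := by
    rw [← sub_mul]; exact mul_pos (by linarith) hL
  set r := Real.exp (w / n) with hr
  have hr1 : 1 ≤ r := Real.one_le_exp (by have := hc0.trans hcw; positivity)
  have hrn : r ^ n = Real.exp w := by
    rw [hr, ← Real.exp_nat_mul]; congr 1; field_simp
  set q₀ := w * L - L - 2 * β with hq
  have hq0 : 0 ≤ q₀ := by rw [hq]; linarith
  obtain ⟨m, hm⟩ := exists_nat_gt (4 * (2 * β) / (w * L - c * L))
  have hm0R : (0 : ℝ) < m := lt_of_le_of_lt (by positivity) hm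
  have hm' : 2 * β / m ≤ (w * L - c * L) / 4 := by
    rw [div_lt_iff₀ hgap] at hm
    rw [div_le_iff₀ hm0R]
    linarith
  -- Of the gap `wL - cL`, one quarter pays the optimum's switching cost and one quarter the errors
  -- of the `n + 1` runs; the remaining half becomes `b` after division by `c`.
  set e := (w * L - c * L) / (4 * c * (n + 1)) with he
  have he0 : 0 < e := by positivity
  obtain ⟨T₀, hT₀⟩ := exists_blocks hβ he0 m (n + 1)
  set T := T₀ + N + 1 with hT
  have hp : ∀ i < n + 1, q₀ * r ^ i + (L + 2 * β) ∈ Set.Icc L U := by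
    intro i hi
    have h1 : 0 ≤ q₀ * r ^ i := by positivity
    have h2 : q₀ * r ^ i ≤ q₀ * r ^ n :=
      mul_le_mul_of_nonneg_left (pow_le_pow_right₀ hr1 (by omega)) hq0
    rw [hrn, hω2] at h2
    exact ⟨by linarith, by linarith⟩
  obtain ⟨h, s, hs, hblock⟩ := hT₀ L U T (A.decision L T) (by omega) hLU
    (A.isSeller hA hLU (by omega)) (fun i => q₀ * r ^ i + (L + 2 * β)) hp
  refine absurd hs (not_le.2 ?_)
  refine one_lt_sum_of_geometric_grid hr1 hq0
    (b := (w * L - c * L) / (2 * c)) (by positivity) hc0 hn fun i hi => ?_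
  obtain ⟨hadm, hsur⟩ := hblock i (by omega)
  have h1 := A.block_le hA hβ.le hβL hLU (by omega) (by exact_mod_cast hm0R) hc0.le hratio hadm
  have h2 : ∑ k ∈ Finset.range (i + 1), (q₀ * r ^ k + (L + 2 * β) - L - 2 * β) * s k =
      ∑ k ∈ Finset.range (i + 1), q₀ * r ^ k * s k :=
    Finset.sum_congr rfl fun k _ => by ring
  rw [h2] at hsur
  set Q := ∑ k ∈ Finset.range (i + 1), q₀ * r ^ k * s k
  have h3 : ((i : ℝ) + 1) * e ≤ (w * L - c * L) / (4 * c) := by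
    calc ((i : ℝ) + 1) * e ≤ (n + 1) * e := by gcongr
      _ = (w * L - c * L) / (4 * c) := by rw [he]; field_simp
  have h4 := mul_le_mul_of_nonneg_left (hsur.trans (add_le_add_right h3 Q)) hc0.le
  have h5 : c * ((w * L - c * L) / (4 * c)) = (w * L - c * L) / 4 := by field_simp
  rw [mul_add, h5] at h4
  rw [mul_add] at h1
  have h6 : (w * L - c * L) / (2 * c) + (q₀ * r ^ i - q₀) / c =
      ((w * L - c * L) / 2 + (q₀ * r ^ i - q₀)) / c := by field_simp
  rw [h6, div_le_iff₀ hc0]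
  linarith
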